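/- \textbf{Conventions.} Graphs are undirected and may have loops; the chromatic number $\chi(X)$ of a graph $X$ is the least number of colors in a vertex coloring in which adjacent vertices always receive different colors, with $\chi(X)=\infty$ if there is no such finite coloring (in particular if $X$ has a loop). A graph is bipartite if its vertex set can be partitioned into two sets $A$ and $B$ such that every edge has one endpoint in $A$ and one in $B$. For an $m\times r$ integer matrix $M$, let $H\subseteq\mathbb{Z}^m$ be the subgroup generated by the columns of $M$, and let $e_1,\dots,e_m$ be the standard basis vectors of $\mathbb{Z}^m$. The standardized Abelian Cayley graph $M^{\mathrm{SACG}}$ is the Cayley graph of $\mathbb{Z}^m/H$ with respect to the set $S=\{\pm e_1+H,\dots,\pm e_m+H\}$: its vertices are the elements of $\mathbb{Z}^m/H$, and each vertex $g$ is adjacent to every vertex $g+s$ with $s\in S$. \textbf{Theorem.} Let $M_X$ be a $5\times 2$ integer matrix and let $X=M_X^{\mathrm{SACG}}$. Suppose that $X$ is not bipartite, that $X$ has no loops, and that no row of $M_X$ is zero. Then $\chi(X)=3$. -/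

import Mathlib

/-- An undirected graph on the vertex set `V`, possibly with loops:
a symmetric adjacency relation. -/
structure LoopGraph (V : Type*) where
  Adj : V → V → Prop
  symm : ∀ u v, Adj u v → Adj v u

namespace LoopGraph

variable {V : Type*}

/-- Some vertex is adjacent to itself. -/
def HasLoops (X : LoopGraph V) : Prop :=
  ∃ v, X.Adj v v

/-- The vertex set is partitioned into `A` and its complement so that every edge has one endpoint
in each part. -/
def IsBipartite (X : LoopGraph V) : Prop :=
  ∃ A : Set V, ∀ u v, X.Adj u v → (u ∈ A ∧ v ∉ A) ∨ (u ∉ A ∧ v ∈ A)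

/-- There is a proper coloring with `n` colors. -/
def Colorable (X : LoopGraph V) (n : ℕ) : Prop :=
  ∃ c : V → Fin n, ∀ u v, X.Adj u v → c u ≠ c v

/-- The least number of colors in a proper coloring, and `⊤` if there is no proper coloring with
finitely many colors; in particular it is `⊤` for a graph with loops. -/
noncomputable def chromaticNumber (X : LoopGraph V) : ℕ∞ :=
  ⨅ n ∈ {n : ℕ | X.Colorable n}, (n : ℕ∞)

end LoopGraph

/-- The Cayley graph of an additive group `G` with respect to a symmetric subset `S`:
each `g` is adjacent to every `g + s` with `s ∈ S`. -/
def addCayleyGraph {G : Type*} [AddGroup G] (S : Set G) (hS : ∀ s ∈ S, -s ∈ S) :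
    LoopGraph G where
  Adj g h := ∃ s ∈ S, h = g + s
  symm := by
    rintro g h ⟨s, hs, rfl⟩
    exact ⟨-s, hS s hs, (add_neg_cancel_right g s).symm⟩

/-- The subgroup of `ℤ^m` generated by the columns of an `m × r` integer matrix. -/
def columnSubgroup {m r : ℕ} (M : Matrix (Fin m) (Fin r) ℤ) : AddSubgroup (Fin m → ℤ) :=
  AddSubgroup.closure (Set.range fun j : Fin r => M.col j)

/-- The images `±e_1, …, ±e_m` of the signed standard basis vectors in the quotient of `ℤ^m` by
the subgroup generated by the columns of `M`. -/
def standardGenerators {m r : ℕ} (M : Matrix (Fin m) (Fin r) ℤ) :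
    Set ((Fin m → ℤ) ⧸ columnSubgroup M) :=
  {s | ∃ i : Fin m, s = QuotientAddGroup.mk (Pi.single i 1) ∨
    s = -QuotientAddGroup.mk (Pi.single i 1)}

theorem neg_mem_standardGenerators {m r : ℕ} (M : Matrix (Fin m) (Fin r) ℤ) :
    ∀ s ∈ standardGenerators M, -s ∈ standardGenerators M := by
  rintro s ⟨i, rfl | rfl⟩
  · exact ⟨i, Or.inr rfl⟩
  · exact ⟨i, Or.inl (neg_neg _)⟩

/-- The standardized Abelian Cayley graph of the integer matrix `M`. -/
def SACG {m r : ℕ} (M : Matrix (Fin m) (Fin r) ℤ) :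
    LoopGraph ((Fin m → ℤ) ⧸ columnSubgroup M) :=
  addCayleyGraph (standardGenerators M) (neg_mem_standardGenerators M)

/-! Write `x`, `y` for the columns. A graph that is not bipartite needs three colors, so the task is
a 3-coloring. It is pulled back from the circle: a homomorphism to ℝ/ℤ that kills `x` and `y` and
moves each `e_i` by at least 1/3 gives one, by cutting the circle into three half-open arcs.

As the phases vary, the pairs (∑ τ x, ∑ τ y) fill a zonotope, which has to meet the coset (3∑x, 3∑y)
+ 6ℤ². Since the graph is not bipartite, some column sum is odd, and a change of basis makes ∑x odd
and ∑y even, with `y` as short as possible in ℓ¹ (`admitsPhases_of_odd`). The coset is then (3, 0) +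
6ℤ².

If every `x + m y` has norm at least 7, minimality of `y` and convex separation put (3, 0) in the
zonotope (`three_le_sum_abs_of_minimal`, `exists_weights_of_le_sum_abs`). Otherwise some `x + m y`
has norm 3 or 5, because norms are odd and norm 1 would be a loop. Then the line ∑ τ x = 3 cuts the
zonotope in a segment, and a case analysis shows that it contains a target; with five nonzero rows
the only obstructions are loops. -/

/-- There are phases `θ i = 1 / 2 + τ i / 6` in `[1 / 3, 2 / 3]` such that `∑ i, θ i * x i` and
`∑ i, θ i * y i` are integers; the two equations say this in terms of `τ`. Then
`n ↦ ∑ i, θ i * n i` modulo `1` is a homomorphism to the circle that kills `x` and `y` and moves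
every standard basis vector by at least a third of the circle. -/
def AdmitsPhases {ι : Type*} [Fintype ι] (x y : ι → ℤ) : Prop :=
  ∃ τ : ι → ℝ, (∀ i, |τ i| ≤ 1) ∧
    (∃ k : ℤ, ∑ i, τ i * x i = 3 * ∑ i, (x i : ℝ) + 6 * k) ∧
    ∃ l : ℤ, ∑ i, τ i * y i = 3 * ∑ i, (y i : ℝ) + 6 * l

/-- The `ℓ¹` norm of an integer vector. -/
def l1Norm {ι : Type*} [Fintype ι] (x : ι → ℤ) : ℕ := ∑ i, (x i).natAbs

/-! ### Phases: symmetries and points of the zonotope. -/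

section Phases

variable {ι : Type*} [Fintype ι]

theorem cast_l1Norm (x : ι → ℤ) : ((l1Norm x : ℕ) : ℝ) = ∑ i, |(x i : ℝ)| := by
  simp [l1Norm, Nat.cast_natAbs]

theorem AdmitsPhases.of_basis_change {x y : ι → ℤ} {p q r s : ℤ} (hdet : p * s - q * r = 1)
    (h : AdmitsPhases (fun i => p * x i + q * y i) (fun i => r * x i + s * y i)) :
    AdmitsPhases x y := by
  obtain ⟨τ, hτ, ⟨k, hk⟩, l, hl⟩ := h
  have hdet' : (p : ℝ) * s - q * r = 1 := by exact_mod_cast hdet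
  have e1 : ∀ a b : ℤ, ∑ i, τ i * ((a * x i + b * y i : ℤ) : ℝ)
      = a * ∑ i, τ i * x i + b * ∑ i, τ i * y i := by
    intro a b
    rw [Finset.mul_sum, Finset.mul_sum, ← Finset.sum_add_distrib]
    exact Finset.sum_congr rfl fun i _ => by push_cast; ring
  have e2 : ∀ a b : ℤ, ∑ i, ((a * x i + b * y i : ℤ) : ℝ)
      = a * ∑ i, (x i : ℝ) + b * ∑ i, (y i : ℝ) := by
    intro a b
    rw [Finset.mul_sum, Finset.mul_sum, ← Finset.sum_add_distrib]
    exact Finset.sum_congr rfl fun i _ => by push_cast; ring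
  rw [e1, e2] at hk hl
  refine ⟨τ, hτ, ⟨s * k - q * l, ?_⟩, p * l - r * k, ?_⟩
  · push_cast
    linear_combination (s : ℝ) * hk - q * hl - (∑ i, τ i * x i - 3 * ∑ i, (x i : ℝ)) * hdet'
  · push_cast
    linear_combination (p : ℝ) * hl - r * hk - (∑ i, τ i * y i - 3 * ∑ i, (y i : ℝ)) * hdet'

theorem AdmitsPhases.of_perm {x y : ι → ℤ} (σ : Equiv.Perm ι)
    (h : AdmitsPhases (x ∘ σ) (y ∘ σ)) : AdmitsPhases x y := by
  obtain ⟨τ, hτ, ⟨k, hk⟩, l, hl⟩ := h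
  refine ⟨τ ∘ σ.symm, fun i => hτ _, ⟨k, ?_⟩, l, ?_⟩
  · rw [← Equiv.sum_comp σ, ← Equiv.sum_comp σ (fun i => (x i : ℝ))]
    simpa using hk
  · rw [← Equiv.sum_comp σ, ← Equiv.sum_comp σ (fun i => (y i : ℝ))]
    simpa using hl

/-- Negating a row replaces its phase θ by 1 - θ modulo 1, and [1/3, 2/3] is symmetric about 1/2. -/
theorem AdmitsPhases.of_sign_change {x y : ι → ℤ} (ε : ι → ℤ) (hε : ∀ i, ε i = 1 ∨ ε i = -1)
    (h : AdmitsPhases (fun i => ε i * x i) (fun i => ε i * y i)) : AdmitsPhases x y := by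
  obtain ⟨τ, hτ, ⟨k, hk⟩, l, hl⟩ := h
  choose δ hδ using fun i => (show ∃ d : ℤ, ε i = 1 + 2 * d by
    rcases hε i with h | h
    · exact ⟨0, by simp [h]⟩
    · exact ⟨-1, by simp [h]⟩)
  have key : ∀ z : ι → ℤ, ∀ k : ℤ,
      ∑ i, τ i * ((ε i * z i : ℤ) : ℝ) = 3 * ∑ i, ((ε i * z i : ℤ) : ℝ) + 6 * k →
      ∃ k : ℤ, ∑ i, τ i * ε i * z i = 3 * ∑ i, (z i : ℝ) + 6 * k := by
    intro z k hk
    refine ⟨k + ∑ i, δ i * z i, ?_⟩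
    have : ∑ i, ((ε i * z i : ℤ) : ℝ) = ∑ i, (z i : ℝ) + 2 * ∑ i, (δ i : ℝ) * z i := by
      rw [Finset.mul_sum, ← Finset.sum_add_distrib]
      exact Finset.sum_congr rfl fun i _ => by rw [hδ]; push_cast; ring
    rw [this] at hk
    push_cast at hk ⊢
    simp only [mul_assoc] at hk ⊢
    linear_combination hk
  refine ⟨fun i => τ i * ε i, fun i => ?_, key x k hk, key y l hl⟩
  rcases hε i with h | h <;> simp [h, hτ i]

theorem AdmitsPhases.of_le_of_le {x y : ι → ℤ} {τ τ' : ι → ℝ} {k l : ℤ}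
    (hτ : ∀ i, |τ i| ≤ 1) (hτ' : ∀ i, |τ' i| ≤ 1)
    (hx : ∑ i, τ i * x i = 3 * ∑ i, (x i : ℝ) + 6 * k)
    (hx' : ∑ i, τ' i * x i = 3 * ∑ i, (x i : ℝ) + 6 * k)
    (hy : ∑ i, τ i * y i ≤ 3 * ∑ i, (y i : ℝ) + 6 * l)
    (hy' : 3 * ∑ i, (y i : ℝ) + 6 * l ≤ ∑ i, τ' i * y i) : AdmitsPhases x y := by
  have hmem : 3 * ∑ i, (y i : ℝ) + 6 * l ∈ segment ℝ (∑ i, τ i * y i) (∑ i, τ' i * y i) := by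
    rw [segment_eq_Icc (hy.trans hy')]
    exact ⟨hy, hy'⟩
  obtain ⟨a, b, ha, hb, hab, h⟩ := hmem
  have e : ∀ z : ι → ℤ, ∑ i, (a * τ i + b * τ' i) * z i
      = a * ∑ i, τ i * z i + b * ∑ i, τ' i * z i := by
    intro z
    rw [Finset.mul_sum, Finset.mul_sum, ← Finset.sum_add_distrib]
    exact Finset.sum_congr rfl fun i _ => by ring
  refine ⟨fun i => a * τ i + b * τ' i, fun i => ?_, ⟨k, ?_⟩, l, ?_⟩
  · have h1 := abs_le.1 (hτ i)
    have h2 := abs_le.1 (hτ' i)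
    rw [abs_le]
    constructor <;> nlinarith
  · rw [e, hx, hx']
    linear_combination (3 * ∑ i, (x i : ℝ) + 6 * k) * hab
  · rw [e, ← h]
    simp

/-- If the `ℓ¹` norm of `x + β y` is at least `3` for every real `β`, then `(3, 0)` lies in the
zonotope spanned by the pairs `(x i, y i)`. -/
theorem exists_weights_of_le_sum_abs (x y : ι → ℤ)
    (h : ∀ β : ℝ, 3 ≤ ∑ i, |(x i : ℝ) + β * y i|) :
    ∃ τ : ι → ℝ, (∀ i, |τ i| ≤ 1) ∧ ∑ i, τ i * x i = 3 ∧ ∑ i, τ i * y i = 0 := by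
  classical
  let L : (ι → ℝ) →ₗ[ℝ] ℝ × ℝ :=
    { toFun := fun τ => (∑ i, τ i * x i, ∑ i, τ i * y i)
      map_add' := fun a b => by simp [add_mul, Finset.sum_add_distrib]
      map_smul' := fun c a => by simp [mul_assoc, Finset.mul_sum] }
  have hL : ∀ τ, L τ = (∑ i, τ i * x i, ∑ i, τ i * y i) := fun _ => rfl
  let K : Set (ι → ℝ) := Set.univ.pi fun _ => Set.Icc (-1) 1
  have hK : IsCompact (L '' K) :=
    (isCompact_univ_pi fun _ => isCompact_Icc).image L.continuous_of_finiteDimensional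
  have hconv : Convex ℝ (L '' K) :=
    (convex_pi fun _ _ => convex_Icc _ _).linear_image L
  by_cases hmem : ((3, 0) : ℝ × ℝ) ∈ L '' K
  · obtain ⟨τ, hτ, hτL⟩ := hmem
    rw [hL, Prod.mk.injEq] at hτL
    exact ⟨τ, fun i => abs_le.2 (hτ i trivial), hτL⟩
  · exfalso
    obtain ⟨f, u, hf, hu⟩ := geometric_hahn_banach_closed_point hconv hK.isClosed hmem
    set α := f (1, 0)
    set β := f (0, 1)
    have hfab : ∀ a b : ℝ, f (a, b) = a * α + b * β := by
      intro a b
      have : ((a, b) : ℝ × ℝ) = a • (1, 0) + b • (0, 1) := by simp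
      rw [this, map_add, map_smul, map_smul]
      rfl
    -- These signs maximize `f` on the zonotope; the maximum is ∑ |α x + β y|.
    let τ : ι → ℝ := fun i => if 0 ≤ α * x i + β * y i then 1 else -1
    have hτ : L τ ∈ L '' K := by
      refine ⟨τ, fun i _ => ?_, rfl⟩
      simp only [τ]
      split_ifs <;> norm_num
    have h1 : ∑ i, |α * x i + β * y i| < 3 * α := by
      have h2 := (hf _ hτ).trans hu
      rw [hL, hfab, hfab, Finset.sum_mul, Finset.sum_mul, ← Finset.sum_add_distrib] at h2
      calc ∑ i, |α * x i + β * y i| = ∑ i, (τ i * x i * α + τ i * y i * β) := by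
            refine Finset.sum_congr rfl fun i _ => ?_
            simp only [τ]
            split_ifs with h0
            · rw [abs_of_nonneg h0]; ring
            · rw [abs_of_neg (not_le.1 h0)]; ring
        _ < 3 * α := by simpa using h2
    have hα : 0 < α := by
      have : 0 ≤ ∑ i, |α * x i + β * y i| := Finset.sum_nonneg fun _ _ => abs_nonneg _
      linarith
    have h3 := h (β / α)
    have h4 : ∑ i, |α * x i + β * y i| = α * ∑ i, |(x i : ℝ) + β / α * y i| := by
      rw [Finset.mul_sum]
      refine Finset.sum_congr rfl fun i _ => ?_
      rw [← abs_of_pos hα, ← abs_mul, abs_of_pos hα]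
      congr 1
      field_simp
    rw [h4] at h1
    nlinarith

/-- Two explicit families of weights: all weights are `1` on the support of `x`, except for one
index `j`, and they are all `1` or all `-1` off the support. -/
theorem AdmitsPhases.of_vertices {x y : ι → ℤ} {e : ℤ} (he : 0 ≤ e)
    (hsum : ∑ i, x i = 3 + e) (heven : Even e) (j j' : ι) (hj : 0 < x j) (hj' : 0 < x j')
    (hej : e ≤ 2 * x j) (hej' : e ≤ 2 * x j') (l : ℤ)
    (hlo : x j * (∑ i, if x i = 0 then -y i else y i) - e * y j ≤ x j * (3 * ∑ i, y i + 6 * l))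
    (hhi : x j' * (3 * ∑ i, y i + 6 * l) ≤ x j' * (∑ i, y i) - e * y j') :
    AdmitsPhases x y := by
  classical
  obtain ⟨d, rfl⟩ := heven
  have bound : ∀ j, 0 < x j → d + d ≤ 2 * x j → |1 - ((d + d : ℤ) : ℝ) / x j| ≤ 1 := by
    intro j hj hej
    have h0 : (0 : ℝ) < x j := by exact_mod_cast hj
    have h1 : ((d + d : ℤ) : ℝ) / x j ≤ 2 := by
      rw [div_le_iff₀ h0]
      exact_mod_cast hej
    have h2 : 0 ≤ ((d + d : ℤ) : ℝ) / x j := div_nonneg (by exact_mod_cast he) h0.le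
    rw [abs_le]
    constructor <;> linarith
  have hsumR : ∑ i, (x i : ℝ) = 3 + (d + d : ℤ) := by exact_mod_cast hsum
  have hsub : ∀ (a : ι → ℝ) (z : ι → ℤ) (c : ℝ) (j : ι),
      ∑ i, (a i - if i = j then c else 0) * (z i : ℝ) = ∑ i, a i * z i - c * z j := by
    intro a z c j
    simp [sub_mul, Finset.sum_sub_distrib]
  -- This `k` puts both points on the line ∑ τ x = 3, as 3(3 + 2d) + 6(-1 - d) = 3.
  refine AdmitsPhases.of_le_of_le (k := -1 - d) (l := l)
    (τ := fun i => (if x i = 0 then -1 else 1) - if i = j then ((d + d : ℤ) : ℝ) / x j else 0)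
    (τ' := fun i => 1 - if i = j' then ((d + d : ℤ) : ℝ) / x j' else 0) ?_ ?_ ?_ ?_ ?_ ?_
  · intro i
    by_cases hij : i = j
    · subst hij
      simpa [hj.ne'] using bound i hj hej
    · simp only [hij, if_false, sub_zero]
      split_ifs <;> simp
  · intro i
    by_cases hij : i = j'
    · subst hij
      simpa using bound i hj' hej'
    · simp [hij]
  · have h0 : (x j : ℝ) ≠ 0 := by exact_mod_cast hj.ne'
    have h1 : ∑ i, (if x i = 0 then (-1 : ℝ) else 1) * x i = ∑ i, (x i : ℝ) :=
      Finset.sum_congr rfl fun i _ => by split_ifs with h <;> simp [h]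
    rw [hsub, h1, div_mul_cancel₀ _ h0, hsumR]
    push_cast
    ring
  · have h0 : (x j' : ℝ) ≠ 0 := by exact_mod_cast hj'.ne'
    rw [hsub]
    simp only [one_mul]
    rw [div_mul_cancel₀ _ h0, hsumR]
    push_cast
    ring
  · have h0 : (0 : ℝ) < x j := by exact_mod_cast hj
    have h1 : ∑ i, (if x i = 0 then (-1 : ℝ) else 1) * y i
        = ((∑ i, if x i = 0 then -y i else y i : ℤ) : ℝ) := by
      push_cast
      exact Finset.sum_congr rfl fun i _ => by split_ifs <;> simp
    rw [hsub, h1, ← mul_le_mul_iff_right₀ h0, mul_sub, ← mul_assoc, mul_div_cancel₀ _ h0.ne']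
    exact_mod_cast hlo
  · have h0 : (0 : ℝ) < x j' := by exact_mod_cast hj'
    rw [hsub]
    simp only [one_mul]
    rw [← mul_le_mul_iff_right₀ h0, mul_sub, ← mul_assoc, mul_div_cancel₀ _ h0.ne']
    exact_mod_cast hhi

end Phases

/-! ### Case analysis for `x` of norm 3 or 5. -/

section SmallNorm

/-- The rows `(x i, y i)` are normalized by signs and sorted lexicographically. -/
structure IsNormalized (x y : Fin 5 → ℤ) : Prop where
  nonneg : ∀ i, 0 ≤ x i
  pos_of_eq_zero : ∀ i, x i = 0 → 0 < y i
  sorted : ∀ i j, i ≤ j → x i < x j ∨ x i = x j ∧ y i ≤ y j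

variable {x y : Fin 5 → ℤ}

/-- Sum 3 over five rows leaves at least two rows with `x i = 0`, each with `y i ≥ 1`. Flipping
their weights sweeps an interval of length at least 4, ending at ∑y. Modulo 6 the targets are 3∑y,
so after halving it suffices that three consecutive integers meet every class modulo 3. -/
theorem IsNormalized.admitsPhases_of_sum_eq_three (h : IsNormalized x y)
    (hsum : ∑ i, x i = 3) :
    AdmitsPhases x y := by
  have n0 := h.nonneg 0
  have m0 := h.sorted 0 1 (by decide)
  have m1 := h.sorted 1 2 (by decide)
  have m2 := h.sorted 2 3 (by decide)
  have m3 := h.sorted 3 4 (by decide)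
  have z0 := h.pos_of_eq_zero 0
  have z1 := h.pos_of_eq_zero 1
  have z2 := h.pos_of_eq_zero 2
  have z3 := h.pos_of_eq_zero 3
  have hsum' := hsum
  rw [Fin.sum_univ_five] at hsum'
  have h4 : 0 < x 4 := by omega
  refine AdmitsPhases.of_vertices le_rfl (by simpa using hsum) (by simp) 4 4
    h4 h4 (by omega) (by omega) ((-∑ i, y i) / 3) ?_ ?_
  · simp only [zero_mul, sub_zero]
    refine mul_le_mul_of_nonneg_left ?_ h4.le
    simp only [Fin.sum_univ_five]
    split_ifs <;> omega
  · simp only [zero_mul, sub_zero]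
    refine mul_le_mul_of_nonneg_left ?_ h4.le
    omega

/-- If `x` and `y` admit no phases, then no integer `3 * ∑ i, y i + 6 * l` lies between the values
attained at the vertices `j` and `j'` of `AdmitsPhases.of_vertices`. -/
theorem exists_window_of_not_admitsPhases (hsum : ∑ i, x i = 5) (hbad : ¬ AdmitsPhases x y)
    (j j' : Fin 5) (hj : 0 < x j) (hj' : 0 < x j') : ∃ l,
      x j * (∑ i, if x i = 0 then -y i else y i) - 2 * y j ≤ x j * (3 * ∑ i, y i + 6 * l) ∧
      x j * (3 * ∑ i, y i + 6 * l) <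
        x j * (∑ i, if x i = 0 then -y i else y i) - 2 * y j + 6 * x j ∧
      x j' * (∑ i, y i) - 2 * y j' < x j' * (3 * ∑ i, y i + 6 * l) := by
  set a := x j * (∑ i, if x i = 0 then -y i else y i) - 2 * y j - x j * (3 * ∑ i, y i) with ha
  have e1 := Int.mul_ediv_add_emod (-a) (6 * x j)
  have e2 := Int.emod_nonneg (-a) (b := 6 * x j) (by omega)
  have e3 := Int.emod_lt_of_pos (-a) (b := 6 * x j) (by omega)
  have e4 : x j * (3 * ∑ i, y i + 6 * (-(-a / (6 * x j))))
      = x j * (3 * ∑ i, y i) - 6 * x j * (-a / (6 * x j)) := by ring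
  have h1 : x j * (∑ i, if x i = 0 then -y i else y i) - 2 * y j
      ≤ x j * (3 * ∑ i, y i + 6 * (-(-a / (6 * x j)))) := by
    rw [e4]; linarith
  -- The ceiling of `a / (6 * x j)`: the first target at or above the value at `j`.
  refine ⟨-(-a / (6 * x j)), h1, by rw [e4]; linarith, ?_⟩
  by_contra h2
  exact hbad (AdmitsPhases.of_vertices (by norm_num) hsum (by decide) j j' hj hj'
    (by omega) (by omega) _ h1 (not_lt.1 h2))

/-- Three zero rows make the interval at least 6 long, the spacing of the targets. -/
theorem IsNormalized.admitsPhases_of_three_zeros (h : IsNormalized x y)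
    (hsum : ∑ i, x i = 5)
    (h0 : x 0 = 0) (h1 : x 1 = 0) (h2 : x 2 = 0) :
    AdmitsPhases x y := by
  have n0 := h.nonneg 0
  have m0 := h.sorted 0 1 (by decide)
  have m1 := h.sorted 1 2 (by decide)
  have m2 := h.sorted 2 3 (by decide)
  have m3 := h.sorted 3 4 (by decide)
  have z0 := h.pos_of_eq_zero 0
  have z1 := h.pos_of_eq_zero 1
  have z2 := h.pos_of_eq_zero 2
  have z3 := h.pos_of_eq_zero 3
  by_contra hbad
  have key := exists_window_of_not_admitsPhases hsum hbad
  simp only [Fin.sum_univ_five] at hsum key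
  have p4 : 0 < x 4 := by omega
  have q0 := z0 h0
  have q1 := z1 h1
  have q2 := z2 h2
  have q3 : (x 3 = 0 ∧ x 4 = 5) ∨ (x 3 = 1 ∧ x 4 = 4) ∨ (x 3 = 2 ∧ x 4 = 3) := by
    omega
  obtain ⟨l, k1, k2, k3⟩ := key 4 4 p4 p4
  clear key m0 m1 m2 m3 z0 z1 z2 hsum n0
  rcases q3 with ⟨h3, h4⟩ | ⟨h3, h4⟩ | ⟨h3, h4⟩ <;>
  · simp only [h0, h1, h2, h3, h4, reduceIte, one_ne_zero, OfNat.ofNat_ne_zero,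
      true_implies] at k1 k2 k3 z3
    omega

/-! The remaining supports of an `x` with sum `5`: the names list the values of `x`. -/

theorem IsNormalized.admitsPhases_of_eq_0_0_1_1_3 (h : IsNormalized x y)
    (hsum : ∑ i, x i = 5)
    (h0 : x 0 = 0) (h1 : x 1 = 0) (h2 : x 2 = 1) (h3 : x 3 = 1) (h4 : x 4 = 3) :
    AdmitsPhases x y := by
  have n0 := h.nonneg 0
  have m0 := h.sorted 0 1 (by decide)
  have m1 := h.sorted 1 2 (by decide)
  have m2 := h.sorted 2 3 (by decide)
  have m3 := h.sorted 3 4 (by decide)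
  have z0 := h.pos_of_eq_zero 0
  have z1 := h.pos_of_eq_zero 1
  have z2 := h.pos_of_eq_zero 2
  have z3 := h.pos_of_eq_zero 3
  by_contra hbad
  have key := exists_window_of_not_admitsPhases hsum hbad
  simp only [Fin.sum_univ_five] at hsum key
  have p4 : 0 < x 4 := by omega
  have q0 := z0 h0
  have q1 := z1 h1
  have r2 : y 2 ≤ y 3 := by omega
  have p2 : 0 < x 2 := by omega
  have p3 : 0 < x 3 := by omega
  have k32 := key 3 2 p3 p2
  have k34 := key 3 4 p3 p4
  have k42 := key 4 2 p4 p2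
  have k44 := key 4 4 p4 p4
  clear key m0 m1 m2 m3 z0 z1 z2 z3 hsum n0
  simp only [h0, h1, h2, h3, h4, reduceIte, one_ne_zero, OfNat.ofNat_ne_zero]
    at k32 k34 k42 k44
  obtain ⟨a, e3⟩ : ∃ a, y 3 = y 2 + a := ⟨y 3 - y 2, by ring⟩
  obtain ⟨b, e4⟩ : ∃ b, y 4 = 3 * y 2 + b := ⟨y 4 - 3 * y 2, by ring⟩
  -- The interval is longest when `j` maximizes the slope `y j / x j` and `j'` minimizes it; its
  -- length is then 2(y 0 + y 1) plus twice the slope spread. Length below 6 forces y 0 = y 1 = 1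
  -- and spread below 1, which bounds `a` and `b`.
  rcases le_total (y 4) (3 * y 3) with c | c <;> rcases le_total (3 * y 2) (y 4) with d | d
  · obtain ⟨l, k1, k2, k3⟩ := k32
    clear k34 k42 k44
    obtain ⟨_, _⟩ : 0 ≤ a ∧ a ≤ 0 := by omega
    obtain ⟨_, _⟩ : -2 ≤ b ∧ b ≤ 2 := by omega
    interval_cases a; interval_cases b <;> omega
  · obtain ⟨l, k1, k2, k3⟩ := k34
    clear k32 k42 k44
    obtain ⟨_, _⟩ : 0 ≤ a ∧ a ≤ 0 := by omega
    obtain ⟨_, _⟩ : -2 ≤ b ∧ b ≤ 2 := by omega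
    interval_cases a; interval_cases b <;> omega
  · obtain ⟨l, k1, k2, k3⟩ := k42
    clear k32 k34 k44
    obtain ⟨_, _⟩ : 0 ≤ a ∧ a ≤ 0 := by omega
    obtain ⟨_, _⟩ : -2 ≤ b ∧ b ≤ 2 := by omega
    interval_cases a; interval_cases b <;> omega
  · obtain ⟨l, k1, k2, k3⟩ := k44
    clear k32 k34 k42
    obtain ⟨_, _⟩ : 0 ≤ a ∧ a ≤ 0 := by omega
    obtain ⟨_, _⟩ : -2 ≤ b ∧ b ≤ 2 := by omega
    interval_cases a; interval_cases b <;> omega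

theorem IsNormalized.admitsPhases_of_eq_0_0_1_2_2 (h : IsNormalized x y)
    (hsum : ∑ i, x i = 5)
    (h0 : x 0 = 0) (h1 : x 1 = 0) (h2 : x 2 = 1) (h3 : x 3 = 2) (h4 : x 4 = 2) :
    AdmitsPhases x y := by
  have n0 := h.nonneg 0
  have m0 := h.sorted 0 1 (by decide)
  have m1 := h.sorted 1 2 (by decide)
  have m2 := h.sorted 2 3 (by decide)
  have m3 := h.sorted 3 4 (by decide)
  have z0 := h.pos_of_eq_zero 0
  have z1 := h.pos_of_eq_zero 1
  have z2 := h.pos_of_eq_zero 2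
  have z3 := h.pos_of_eq_zero 3
  by_contra hbad
  have key := exists_window_of_not_admitsPhases hsum hbad
  simp only [Fin.sum_univ_five] at hsum key
  have p4 : 0 < x 4 := by omega
  have q0 := z0 h0
  have q1 := z1 h1
  have r3 : y 3 ≤ y 4 := by omega
  have p2 : 0 < x 2 := by omega
  have p3 : 0 < x 3 := by omega
  have k22 := key 2 2 p2 p2
  have k23 := key 2 3 p2 p3
  have k42 := key 4 2 p4 p2
  have k43 := key 4 3 p4 p3
  clear key m0 m1 m2 m3 z0 z1 z2 z3 hsum n0
  simp only [h0, h1, h2, h3, h4, reduceIte, one_ne_zero, OfNat.ofNat_ne_zero]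
    at k22 k23 k42 k43
  obtain ⟨a, e3⟩ : ∃ a, y 3 = 2 * y 2 + a := ⟨y 3 - 2 * y 2, by ring⟩
  obtain ⟨b, e4⟩ : ∃ b, y 4 = 2 * y 2 + b := ⟨y 4 - 2 * y 2, by ring⟩
  rcases le_total (y 4) (2 * y 2) with c | c <;> rcases le_total (2 * y 2) (y 3) with d | d
  · obtain ⟨l, k1, k2, k3⟩ := k22
    clear k23 k42 k43
    obtain ⟨_, _⟩ : -1 ≤ a ∧ a ≤ 1 := by omega
    obtain ⟨_, _⟩ : -1 ≤ b ∧ b ≤ 1 := by omega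
    interval_cases a <;> interval_cases b <;> omega
  · obtain ⟨l, k1, k2, k3⟩ := k23
    clear k22 k42 k43
    obtain ⟨_, _⟩ : -1 ≤ a ∧ a ≤ 1 := by omega
    obtain ⟨_, _⟩ : -1 ≤ b ∧ b ≤ 1 := by omega
    interval_cases a <;> interval_cases b <;> omega
  · obtain ⟨l, k1, k2, k3⟩ := k42
    clear k22 k23 k43
    obtain ⟨_, _⟩ : -1 ≤ a ∧ a ≤ 1 := by omega
    obtain ⟨_, _⟩ : -1 ≤ b ∧ b ≤ 1 := by omega
    interval_cases a <;> interval_cases b <;> omega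
  · obtain ⟨l, k1, k2, k3⟩ := k43
    clear k22 k23 k42
    obtain ⟨_, _⟩ : -1 ≤ a ∧ a ≤ 1 := by omega
    obtain ⟨_, _⟩ : -1 ≤ b ∧ b ≤ 1 := by omega
    interval_cases a <;> interval_cases b <;> omega

theorem IsNormalized.admitsPhases_of_eq_0_1_1_1_2 (h : IsNormalized x y)
    (hsum : ∑ i, x i = 5) (hloop : ∀ k : ℤ, ∑ i, (y i - k * x i).natAbs ≠ 1)
    (h0 : x 0 = 0) (h1 : x 1 = 1) (h2 : x 2 = 1) (h3 : x 3 = 1) (h4 : x 4 = 2) :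
    AdmitsPhases x y := by
  have n0 := h.nonneg 0
  have m0 := h.sorted 0 1 (by decide)
  have m1 := h.sorted 1 2 (by decide)
  have m2 := h.sorted 2 3 (by decide)
  have m3 := h.sorted 3 4 (by decide)
  have z0 := h.pos_of_eq_zero 0
  have z1 := h.pos_of_eq_zero 1
  have z2 := h.pos_of_eq_zero 2
  have z3 := h.pos_of_eq_zero 3
  by_contra hbad
  have key := exists_window_of_not_admitsPhases hsum hbad
  simp only [Fin.sum_univ_five] at hsum hloop key
  have p4 : 0 < x 4 := by omega
  have q0 := z0 h0
  have r1 : y 1 ≤ y 2 := by omega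
  have r2 : y 2 ≤ y 3 := by omega
  have p1 : 0 < x 1 := by omega
  have p3 : 0 < x 3 := by omega
  -- Excludes `y = y 1 • x + e_0`.
  have l1 := hloop (y 1)
  have k31 := key 3 1 p3 p1
  have k34 := key 3 4 p3 p4
  have k41 := key 4 1 p4 p1
  have k44 := key 4 4 p4 p4
  clear key hloop m0 m1 m2 m3 z0 z1 z2 z3 hsum n0
  simp only [h0, h1, h2, h3, h4, reduceIte, one_ne_zero, OfNat.ofNat_ne_zero]
    at k31 k34 k41 k44 l1
  obtain ⟨a, e2⟩ : ∃ a, y 2 = y 1 + a := ⟨y 2 - y 1, by ring⟩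
  obtain ⟨b, e3⟩ : ∃ b, y 3 = y 1 + b := ⟨y 3 - y 1, by ring⟩
  obtain ⟨g, e4⟩ : ∃ g, y 4 = 2 * y 1 + g := ⟨y 4 - 2 * y 1, by ring⟩
  rcases le_total (y 4) (2 * y 3) with c | c <;> rcases le_total (2 * y 1) (y 4) with d | d
  · obtain ⟨l, k1, k2, k3⟩ := k31
    clear k34 k41 k44
    obtain ⟨_, _⟩ : 1 ≤ y 0 ∧ y 0 ≤ 2 := by omega
    obtain ⟨_, _⟩ : 0 ≤ b ∧ b ≤ 1 := by omega
    obtain ⟨_, _⟩ : 0 ≤ a ∧ a ≤ 1 := by omega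
    obtain ⟨_, _⟩ : -3 ≤ g ∧ g ≤ 3 := by omega
    interval_cases hz : y 0 <;> interval_cases b <;> interval_cases a <;> interval_cases g <;>
        omega
  · obtain ⟨l, k1, k2, k3⟩ := k34
    clear k31 k41 k44
    obtain ⟨_, _⟩ : 1 ≤ y 0 ∧ y 0 ≤ 2 := by omega
    obtain ⟨_, _⟩ : 0 ≤ b ∧ b ≤ 1 := by omega
    obtain ⟨_, _⟩ : 0 ≤ a ∧ a ≤ 1 := by omega
    obtain ⟨_, _⟩ : -3 ≤ g ∧ g ≤ 3 := by omega
    interval_cases hz : y 0 <;> interval_cases b <;> interval_cases a <;> interval_cases g <;>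
        omega
  · obtain ⟨l, k1, k2, k3⟩ := k41
    clear k31 k34 k44
    obtain ⟨_, _⟩ : 1 ≤ y 0 ∧ y 0 ≤ 2 := by omega
    obtain ⟨_, _⟩ : 0 ≤ b ∧ b ≤ 1 := by omega
    obtain ⟨_, _⟩ : 0 ≤ a ∧ a ≤ 1 := by omega
    obtain ⟨_, _⟩ : -3 ≤ g ∧ g ≤ 3 := by omega
    interval_cases hz : y 0 <;> interval_cases b <;> interval_cases a <;> interval_cases g <;>
        omega
  · obtain ⟨l, k1, k2, k3⟩ := k44
    clear k31 k34 k41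
    obtain ⟨_, _⟩ : 1 ≤ y 0 ∧ y 0 ≤ 2 := by omega
    obtain ⟨_, _⟩ : 0 ≤ b ∧ b ≤ 1 := by omega
    obtain ⟨_, _⟩ : 0 ≤ a ∧ a ≤ 1 := by omega
    obtain ⟨_, _⟩ : -3 ≤ g ∧ g ≤ 3 := by omega
    interval_cases hz : y 0 <;> interval_cases b <;> interval_cases a <;> interval_cases g <;>
        omega

theorem IsNormalized.admitsPhases_of_eq_1_1_1_1_1 (h : IsNormalized x y)
    (hsum : ∑ i, x i = 5) (hloop : ∀ k : ℤ, ∑ i, (y i - k * x i).natAbs ≠ 1)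
    (h0 : x 0 = 1) (h1 : x 1 = 1) (h2 : x 2 = 1) (h3 : x 3 = 1) (h4 : x 4 = 1) :
    AdmitsPhases x y := by
  have n0 := h.nonneg 0
  have m0 := h.sorted 0 1 (by decide)
  have m1 := h.sorted 1 2 (by decide)
  have m2 := h.sorted 2 3 (by decide)
  have m3 := h.sorted 3 4 (by decide)
  have z0 := h.pos_of_eq_zero 0
  have z1 := h.pos_of_eq_zero 1
  have z2 := h.pos_of_eq_zero 2
  have z3 := h.pos_of_eq_zero 3
  by_contra hbad
  have key := exists_window_of_not_admitsPhases hsum hbad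
  simp only [Fin.sum_univ_five] at hsum hloop key
  have p4 : 0 < x 4 := by omega
  have r0 : y 0 ≤ y 1 := by omega
  have r1 : y 1 ≤ y 2 := by omega
  have r2 : y 2 ≤ y 3 := by omega
  have r3 : y 3 ≤ y 4 := by omega
  have p0 : 0 < x 0 := by omega
  -- A miss forces y 4 = y 0 + 1 with one or four entries equal to y 4; then `y - y 0 • x = e_4` or
  -- `y - y 4 • x = -e_0`, both loops.
  have l0 := hloop (y 0)
  have l4 := hloop (y 4)
  have k40 := key 4 0 p4 p0
  clear key hloop m0 m1 m2 m3 z0 z1 z2 z3 hsum n0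
  simp only [h0, h1, h2, h3, h4, reduceIte, one_ne_zero]
    at k40 l0 l4
  obtain ⟨l, k1, k2, k3⟩ := k40
  omega

theorem IsNormalized.admitsPhases_of_sum_eq_five (h : IsNormalized x y)
    (hsum : ∑ i, x i = 5) (hloop : ∀ k : ℤ, ∑ i, (y i - k * x i).natAbs ≠ 1) :
    AdmitsPhases x y := by
  have n0 := h.nonneg 0
  have m0 := h.sorted 0 1 (by decide)
  have m1 := h.sorted 1 2 (by decide)
  have m2 := h.sorted 2 3 (by decide)
  have m3 := h.sorted 3 4 (by decide)
  have hsum' := hsum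
  rw [Fin.sum_univ_five] at hsum'
  have patterns :
      (x 0 = 0 ∧ x 1 = 0 ∧ x 2 = 0) ∨
      (x 0 = 0 ∧ x 1 = 0 ∧ x 2 = 1 ∧ x 3 = 1 ∧ x 4 = 3) ∨
      (x 0 = 0 ∧ x 1 = 0 ∧ x 2 = 1 ∧ x 3 = 2 ∧ x 4 = 2) ∨
      (x 0 = 0 ∧ x 1 = 1 ∧ x 2 = 1 ∧ x 3 = 1 ∧ x 4 = 2) ∨
      (x 0 = 1 ∧ x 1 = 1 ∧ x 2 = 1 ∧ x 3 = 1 ∧ x 4 = 1) := by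
    have w0 : x 0 ≤ x 1 := by omega
    have w1 : x 1 ≤ x 2 := by omega
    have w2 : x 2 ≤ x 3 := by omega
    have w3 : x 3 ≤ x 4 := by omega
    clear m0 m1 m2 m3 hloop h hsum
    have b0 : x 0 ≤ 1 := by omega
    have b1 : x 1 ≤ 1 := by omega
    have b2 : x 2 ≤ 1 := by omega
    have b3 : x 3 ≤ 2 := by omega
    generalize x 0 = a0 at *
    generalize x 1 = a1 at *
    generalize x 2 = a2 at *
    generalize x 3 = a3 at *
    interval_cases a0 <;> interval_cases a1 <;> interval_cases a2 <;> interval_cases a3 <;> omega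
  rcases patterns with ⟨h0, h1, h2⟩ | ⟨h0, h1, h2, h3, h4⟩ | ⟨h0, h1, h2, h3, h4⟩ |
    ⟨h0, h1, h2, h3, h4⟩ | ⟨h0, h1, h2, h3, h4⟩
  · exact h.admitsPhases_of_three_zeros hsum h0 h1 h2
  · exact h.admitsPhases_of_eq_0_0_1_1_3 hsum h0 h1 h2 h3 h4
  · exact h.admitsPhases_of_eq_0_0_1_2_2 hsum h0 h1 h2 h3 h4
  · exact h.admitsPhases_of_eq_0_1_1_1_2 hsum hloop h0 h1 h2 h3 h4
  · exact h.admitsPhases_of_eq_1_1_1_1_1 hsum hloop h0 h1 h2 h3 h4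

end SmallNorm

/-! ### Existence of phases when a column sum is odd. -/

section Existence

theorem odd_l1Norm {ι : Type*} [Fintype ι] {x : ι → ℤ} (h : Odd (∑ i, x i)) :
    Odd (l1Norm x) := by
  have h1 : (2 : ℤ) ∣ ((l1Norm x : ℕ) : ℤ) - ∑ i, x i := by
    rw [l1Norm, Nat.cast_sum, ← Finset.sum_sub_distrib]
    exact Finset.dvd_sum fun i _ => by omega
  rw [Int.odd_iff] at h
  rw [Nat.odd_iff]
  omega

variable {x y : Fin 5 → ℤ}

theorem admitsPhases_of_l1Norm_eq (hrow : ∀ i, x i ≠ 0 ∨ y i ≠ 0)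
    (hloop : ∀ p q : ℤ, l1Norm (fun i => p * x i + q * y i) ≠ 1)
    (hx : l1Norm x = 3 ∨ l1Norm x = 5) : AdmitsPhases x y := by
  let ε : Fin 5 → ℤ := fun i => if 0 < x i ∨ x i = 0 ∧ 0 < y i then 1 else -1
  have hε : ∀ i, ε i = 1 ∨ ε i = -1 := fun i => by
    simp only [ε]
    split_ifs <;> simp
  have hεx : ∀ i, ε i * x i = (x i).natAbs := fun i => by
    simp only [ε]
    split_ifs <;> omega
  have hεy : ∀ i, x i = 0 → 0 < ε i * y i := fun i h => by
    have := hrow i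
    simp only [ε]
    split_ifs <;> omega
  refine AdmitsPhases.of_sign_change ε hε ?_
  set x' : Fin 5 → ℤ := fun i => ε i * x i with hx'
  set y' : Fin 5 → ℤ := fun i => ε i * y i with hy'
  let f : Fin 5 → ℤ ×ₗ ℤ := fun i => toLex (x' i, y' i)
  have hmono : Monotone (f ∘ Tuple.sort f) := Tuple.monotone_sort f
  set σ := Tuple.sort f
  refine AdmitsPhases.of_perm σ ?_
  have hnorm : IsNormalized (x' ∘ σ) (y' ∘ σ) := by
    refine ⟨fun i => ?_, fun i hi => ?_, fun i j hij => ?_⟩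
    · simp [hx', hεx]
    · refine hεy _ ?_
      simpa [hx', hεx] using hi
    · simpa [f, Prod.Lex.toLex_le_toLex] using hmono hij
  have hsum : ∑ i, (x' ∘ σ) i = l1Norm x := by
    rw [l1Norm, Nat.cast_sum, ← Equiv.sum_comp σ (fun i => ((x i).natAbs : ℤ))]
    exact Finset.sum_congr rfl fun i _ => hεx _
  rcases hx with hx | hx <;> rw [hx] at hsum
  · exact hnorm.admitsPhases_of_sum_eq_three hsum
  · refine hnorm.admitsPhases_of_sum_eq_five hsum fun k hk => hloop (-k) 1 ?_
    rw [← hk, l1Norm, ← Equiv.sum_comp σ (fun i => (-k * x i + 1 * y i).natAbs)]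
    refine Finset.sum_congr rfl fun i _ => ?_
    have : (y' ∘ σ) i - k * (x' ∘ σ) i = ε (σ i) * (-k * x (σ i) + 1 * y (σ i)) := by
      simp only [hx', hy', Function.comp]
      ring
    rw [this, Int.natAbs_mul]
    rcases hε (σ i) with h | h <;> simp [h]

/-- Let N be the norm of `x + β y` and β = m + δ with |δ| ≤ 1/2. The bound 7 gives 7 ≤ N + |δ|‖y‖,
and minimality gives |δ|‖y‖ ≤ N, so N ≥ 7/2. -/
theorem three_le_sum_abs_of_minimal {ι : Type*} [Fintype ι] {x y : ι → ℤ}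
    (hseven : ∀ m : ℤ, 7 ≤ l1Norm (fun i => x i + m * y i))
    (hmin : ∀ m c : ℤ, (c = 1 ∨ c = -1) →
      l1Norm y ≤ l1Norm (fun i => y i + 2 * c * (x i + m * y i))) (β : ℝ) :
    3 ≤ ∑ i, |(x i : ℝ) + β * y i| := by
  by_contra! hβ
  obtain ⟨m, δ, rfl, hδ⟩ : ∃ (m : ℤ) (δ : ℝ), β = m + δ ∧ |δ| ≤ 1 / 2 :=
    ⟨round β, β - round β, by ring, abs_sub_round β⟩
  obtain ⟨c, hc, hcδ⟩ : ∃ c : ℤ, (c = 1 ∨ c = -1) ∧ (c : ℝ) * δ = |δ| := by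
    rcases le_total 0 δ with h | h
    · exact ⟨1, Or.inl rfl, by simp [abs_of_nonneg h]⟩
    · exact ⟨-1, Or.inr rfl, by simp [abs_of_nonpos h]⟩
  have habs : |(c : ℝ)| = 1 := by rcases hc with rfl | rfl <;> simp
  have h1 : (7 : ℝ) ≤ ∑ i, |(x i : ℝ) + (m + δ) * y i| + |δ| * ∑ i, |(y i : ℝ)| := by
    have h : ((7 : ℕ) : ℝ) ≤ _ := Nat.cast_le.2 (hseven m)
    rw [cast_l1Norm, Nat.cast_ofNat] at h
    rw [Finset.mul_sum, ← Finset.sum_add_distrib]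
    refine h.trans (Finset.sum_le_sum fun i _ => ?_)
    rw [← abs_mul]
    refine le_trans (le_of_eq ?_) (abs_sub _ _)
    push_cast
    congr 1
    ring
  have h2 : ∑ i, |(y i : ℝ)| ≤
      2 * ∑ i, |(x i : ℝ) + (m + δ) * y i| + (1 - 2 * |δ|) * ∑ i, |(y i : ℝ)| := by
    have h : ((_ : ℕ) : ℝ) ≤ _ := Nat.cast_le.2 (hmin m c hc)
    rw [cast_l1Norm, cast_l1Norm] at h
    rw [Finset.mul_sum, Finset.mul_sum, ← Finset.sum_add_distrib]
    refine h.trans (Finset.sum_le_sum fun i _ => ?_)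
    have e1 : 2 * |(x i : ℝ) + (m + δ) * y i| = |2 * c * ((x i : ℝ) + (m + δ) * y i)| := by
      rw [abs_mul, abs_mul, habs]
      simp
    have e2 : (1 - 2 * |δ|) * |(y i : ℝ)| = |(1 - 2 * |δ|) * y i| := by
      rw [abs_mul, abs_of_nonneg (by linarith : (0 : ℝ) ≤ 1 - 2 * |δ|)]
    rw [e1, e2]
    refine le_trans (le_of_eq ?_) (abs_add_le _ _)
    push_cast
    congr 1
    rw [← hcδ]
    ring
  linarith

theorem admitsPhases_of_minimal (hrow : ∀ i, x i ≠ 0 ∨ y i ≠ 0)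
    (hloop : ∀ p q : ℤ, l1Norm (fun i => p * x i + q * y i) ≠ 1)
    (hodd : Odd (∑ i, x i)) (heven : Even (∑ i, y i))
    (hmin : ∀ m c : ℤ, (c = 1 ∨ c = -1) →
      l1Norm y ≤ l1Norm (fun i => y i + 2 * c * (x i + m * y i))) : AdmitsPhases x y := by
  by_cases hsmall : ∃ m : ℤ, l1Norm (fun i => x i + m * y i) = 3 ∨
      l1Norm (fun i => x i + m * y i) = 5
  · obtain ⟨m, hm⟩ := hsmall
    refine AdmitsPhases.of_basis_change (p := 1) (q := m) (r := 0) (s := 1) (by ring) ?_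
    simp only [one_mul, zero_mul, zero_add]
    refine admitsPhases_of_l1Norm_eq (fun i => ?_) (fun p q => ?_) hm
    · by_cases h : y i = 0
      · simpa [h] using hrow i
      · exact Or.inr h
    · convert hloop p (p * m + q) using 3
      ring
  · push Not at hsmall
    have hseven : ∀ m : ℤ, 7 ≤ l1Norm (fun i => x i + m * y i) := by
      intro m
      have h1 := hsmall m
      have h2 := hloop 1 m
      simp only [one_mul] at h2
      have h3 : Odd (∑ i, (x i + m * y i)) := by
        rw [Finset.sum_add_distrib, ← Finset.mul_sum]
        exact hodd.add_even (heven.mul_left m)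
      obtain ⟨j, hj⟩ := odd_l1Norm h3
      omega
    obtain ⟨τ, hτ, h1, h2⟩ := exists_weights_of_le_sum_abs x y
      (three_le_sum_abs_of_minimal hseven hmin)
    obtain ⟨k, hk⟩ := hodd
    obtain ⟨l, hl⟩ := heven
    have hk' : ∑ i, (x i : ℝ) = 2 * k + 1 := by exact_mod_cast hk
    have hl' : ∑ i, (y i : ℝ) = l + l := by exact_mod_cast hl
    refine ⟨τ, hτ, ⟨-k, ?_⟩, -l, ?_⟩
    · rw [h1, hk']
      push_cast
      ring
    · rw [h2, hl']
      push_cast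
      ring

theorem admitsPhases_of_odd (hrow : ∀ i, x i ≠ 0 ∨ y i ≠ 0)
    (hloop : ∀ p q : ℤ, l1Norm (fun i => p * x i + q * y i) ≠ 1)
    (hodd : Odd (∑ i, x i) ∨ Odd (∑ i, y i)) : AdmitsPhases x y := by
  classical
  have hsum : ∀ p q : ℤ, ∑ i, (p * x i + q * y i) = p * ∑ i, x i + q * ∑ i, y i := fun p q => by
    rw [Finset.sum_add_distrib, Finset.mul_sum, Finset.mul_sum]
  have hex : ∃ n, ∃ p q r s : ℤ, p * s - q * r = 1 ∧ Even (∑ i, (r * x i + s * y i)) ∧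
      l1Norm (fun i => r * x i + s * y i) = n := by
    rcases Int.even_or_odd (∑ i, y i) with hy | hy
    · exact ⟨_, 1, 0, 0, 1, by ring, by simpa using hy, rfl⟩
    · rcases Int.even_or_odd (∑ i, x i) with hx | hx
      · exact ⟨_, 0, -1, 1, 0, by ring, by simpa using hx, rfl⟩
      -- Both sums are odd, so `x + y` is the even vector.
      · exact ⟨_, 1, 0, 1, 1, by ring, by simpa [Finset.sum_add_distrib] using hx.add_odd hy, rfl⟩
  obtain ⟨p, q, r, s, hdet, heven, hn⟩ := Nat.find_spec hex
  have hmin := fun n => Nat.find_min' hex (m := n)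
  rw [← hn] at hmin
  refine AdmitsPhases.of_basis_change hdet (admitsPhases_of_minimal (fun i => ?_)
    (fun a b => ?_) ?_ heven fun m c hc => ?_)
  · by_contra! h
    obtain ⟨h1, h2⟩ := h
    have hx : x i = 0 := by linear_combination s * h1 - q * h2 - x i * hdet
    have hy : y i = 0 := by linear_combination p * h2 - r * h1 - y i * hdet
    exact (hrow i).elim (· hx) (· hy)
  · convert hloop (a * p + b * r) (a * q + b * s) using 3
    ring
  · by_contra h
    rw [Int.not_odd_iff_even] at h
    rw [hsum] at h heven
    have hx : Even (∑ i, x i) := by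
      have : ∑ i, x i = s * (p * ∑ i, x i + q * ∑ i, y i)
          - q * (r * ∑ i, x i + s * ∑ i, y i) := by
        linear_combination -(∑ i, x i) * hdet
      rw [this]
      exact (h.mul_left s).sub (heven.mul_left q)
    have hy : Even (∑ i, y i) := by
      have : ∑ i, y i = p * (r * ∑ i, x i + s * ∑ i, y i)
          - r * (p * ∑ i, x i + q * ∑ i, y i) := by
        linear_combination -(∑ i, y i) * hdet
      rw [this]
      exact (heven.mul_left p).sub (h.mul_left r)
    rw [← Int.not_odd_iff_even] at hx hy
    exact hodd.elim hx hy
  -- With (u, v) the chosen basis, (u + m v, v + 2c(u + m v)) is a basis whose second vector still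
  -- has even sum.
  · refine hmin _ ⟨p + m * r, q + m * s, r + 2 * c * (p + m * r), s + 2 * c * (q + m * s),
      by linear_combination hdet, ?_, ?_⟩
    · have : ∑ i, ((r + 2 * c * (p + m * r)) * x i + (s + 2 * c * (q + m * s)) * y i)
          = ∑ i, (r * x i + s * y i)
            + 2 * (c * ((p + m * r) * ∑ i, x i + (q + m * s) * ∑ i, y i)) := by
        rw [hsum, hsum]
        ring
      rw [this]
      exact heven.add (even_two_mul _)
    · congr 1
      funext i
      ring

end Existence

/-! ### From phases to colorings; bipartiteness and loops. -/

section Coloring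

theorem LoopGraph.isBipartite_of_colorable {V : Type*} {X : LoopGraph V} {n : ℕ}
    (h : X.Colorable n) (hn : n < 3) : X.IsBipartite := by
  obtain ⟨c, hc⟩ := h
  refine ⟨{v | (c v : ℕ) = 0}, fun u v huv => ?_⟩
  have h1 : (c u : ℕ) ≠ c v := fun h => hc u v huv (Fin.ext h)
  have h2 := (c u).isLt
  have h3 := (c v).isLt
  simp only [Set.mem_ofPred_eq]
  omega

theorem LoopGraph.chromaticNumber_eq_three {V : Type*} {X : LoopGraph V}
    (h : X.Colorable 3) (hX : ¬ X.IsBipartite) : X.chromaticNumber = 3 := by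
  refine le_antisymm (iInf₂_le 3 h) (le_iInf₂ fun n hn => ?_)
  have : 3 ≤ n := by
    by_contra h3
    exact hX (LoopGraph.isBipartite_of_colorable hn (not_le.1 h3))
  exact_mod_cast this

/-- Color a real number by the third of `[0, 1)` that contains its fractional part. -/
noncomputable def thirdColor (t : ℝ) : Fin 3 :=
  ⟨⌊3 * Int.fract t⌋.toNat, by
    have h1 : ⌊3 * Int.fract t⌋ < 3 :=
      Int.floor_lt.2 (by push_cast; linarith [Int.fract_lt_one t])
    omega⟩

/-- Points of one half-open third differ by less than 1/3, so the integer `⌊t⌋ - ⌊s⌋ - k` would lie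
strictly between 0 and 1. -/
theorem thirdColor_ne {s t θ : ℝ} {k : ℤ} (h1 : 1 / 3 ≤ θ) (h2 : θ ≤ 2 / 3)
    (h : t = s + θ + k) : thirdColor s ≠ thirdColor t := by
  intro hst
  have hs : 0 ≤ ⌊3 * Int.fract s⌋ := Int.floor_nonneg.2 (by linarith [Int.fract_nonneg s])
  have ht : 0 ≤ ⌊3 * Int.fract t⌋ := Int.floor_nonneg.2 (by linarith [Int.fract_nonneg t])
  have hfl : ⌊3 * Int.fract s⌋ = ⌊3 * Int.fract t⌋ := by
    have := congrArg Fin.val hst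
    simp only [thirdColor] at this
    omega
  have habs := abs_lt.1 (Int.abs_sub_lt_one_of_floor_eq_floor hfl)
  have e : Int.fract s - Int.fract t = ((⌊t⌋ - ⌊s⌋ - k : ℤ) : ℝ) - θ := by
    push_cast
    linarith [Int.fract_add_floor s, Int.fract_add_floor t]
  have g1 : ((0 : ℤ) : ℝ) < ((⌊t⌋ - ⌊s⌋ - k : ℤ) : ℝ) := by
    rw [Int.cast_zero]
    linarith [habs.1]
  have g2 : ((⌊t⌋ - ⌊s⌋ - k : ℤ) : ℝ) < ((1 : ℤ) : ℝ) := by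
    rw [Int.cast_one]
    linarith [habs.2]
  rw [Int.cast_lt] at g1 g2
  omega

variable {m : ℕ}

theorem SACG_colorable_three (M : Matrix (Fin m) (Fin 2) ℤ)
    (h : AdmitsPhases (M.col 0) (M.col 1)) : (SACG M).Colorable 3 := by
  obtain ⟨τ, hτ, ⟨k, hk⟩, l, hl⟩ := h
  let φ : (Fin m → ℤ) →+ ℝ :=
    { toFun := fun n => ∑ i, (1 / 2 + τ i / 6) * n i
      map_zero' := by simp
      map_add' := fun a b => by simp [mul_add, Finset.sum_add_distrib] }
  have hφ : ∀ n, φ n = ∑ i, (1 / 2 + τ i / 6) * n i := fun _ => rfl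
  have hφ' : ∀ n, φ n = (∑ i, (n i : ℝ)) / 2 + (∑ i, τ i * n i) / 6 := by
    intro n
    rw [hφ, Finset.sum_div, Finset.sum_div, ← Finset.sum_add_distrib]
    exact Finset.sum_congr rfl fun i _ => by ring
  -- Changing the representative of a coset changes `φ` by an integer, which `thirdColor_ne`
  -- absorbs.
  have hH : columnSubgroup M ≤ (Int.castAddHom ℝ).range.comap φ := by
    rw [columnSubgroup, AddSubgroup.closure_le]
    rintro _ ⟨j, rfl⟩
    fin_cases j
    · refine ⟨∑ i, M.col 0 i + k, ?_⟩
      simp only [Fin.zero_eta, hφ', hk, Int.coe_castAddHom]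
      push_cast
      ring
    · refine ⟨∑ i, M.col 1 i + l, ?_⟩
      simp only [Fin.mk_one, hφ', hl, Int.coe_castAddHom]
      push_cast
      ring
  have key : ∀ (u v : (Fin m → ℤ) ⧸ columnSubgroup M) (i : Fin m),
      v = u + QuotientAddGroup.mk (Pi.single i 1) →
      thirdColor (φ u.out) ≠ thirdColor (φ v.out) := by
    intro u v i huv
    have hmem : -(u.out + Pi.single i 1) + v.out ∈ columnSubgroup M := by
      rw [← QuotientAddGroup.eq, QuotientAddGroup.mk_add, QuotientAddGroup.out_eq',
        QuotientAddGroup.out_eq', huv]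
    obtain ⟨n, hn⟩ := hH hmem
    have hsingle : φ (Pi.single i 1) = 1 / 2 + τ i / 6 := by
      rw [hφ, Finset.sum_eq_single i] <;> simp +contextual
    simp only [Int.coe_castAddHom, map_add, map_neg, hsingle] at hn
    have hb := abs_le.1 (hτ i)
    exact thirdColor_ne (θ := 1 / 2 + τ i / 6) (k := n) (by linarith) (by linarith) (by linarith)
  refine ⟨fun v => thirdColor (φ v.out), fun u v huv => ?_⟩
  obtain ⟨s, ⟨i, rfl | rfl⟩, hv⟩ := huv
  · exact key u v i hv
  · exact (key v u i (by rw [hv, neg_add_cancel_right])).symm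

theorem SACG_isBipartite_of_even {r : ℕ} (M : Matrix (Fin m) (Fin r) ℤ)
    (h : ∀ j, Even (∑ i, M i j)) : (SACG M).IsBipartite := by
  let ψ₀ : (Fin m → ℤ) →+ ZMod 2 :=
    { toFun := fun n => ((∑ i, n i : ℤ) : ZMod 2)
      map_zero' := by simp
      map_add' := fun a b => by simp [Finset.sum_add_distrib] }
  have hψ₀ : ∀ n, ψ₀ n = ((∑ i, n i : ℤ) : ZMod 2) := fun _ => rfl
  have hker : columnSubgroup M ≤ ψ₀.ker := by
    rw [columnSubgroup, AddSubgroup.closure_le]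
    rintro _ ⟨j, rfl⟩
    change ψ₀ _ = 0
    rw [hψ₀, ZMod.intCast_zmod_eq_zero_iff_dvd]
    exact (h j).two_dvd
  let ψ := QuotientAddGroup.lift (columnSubgroup M) ψ₀ hker
  have hsingle : ∀ i, ψ (QuotientAddGroup.mk (Pi.single i 1)) = 1 := fun i => by
    change ψ₀ _ = 1
    simp [hψ₀]
  refine ⟨{g | ψ g = 0}, fun u v huv => ?_⟩
  have hv : ψ v = ψ u + 1 := by
    obtain ⟨s, ⟨i, rfl | rfl⟩, rfl⟩ := huv
    · rw [map_add, hsingle]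
    · rw [map_add, map_neg, hsingle]
      rfl
  simp only [Set.mem_ofPred_eq, hv]
  generalize ψ u = a
  revert a
  decide

theorem SACG_hasLoops_of_l1Norm_eq_one {r : ℕ} (M : Matrix (Fin m) (Fin r) ℤ) {n : Fin m → ℤ}
    (hn : n ∈ columnSubgroup M) (h : l1Norm n = 1) : (SACG M).HasLoops := by
  obtain ⟨i, hi⟩ : ∃ i, n i ≠ 0 := by
    by_contra! h0
    simp [l1Norm, h0] at h
  have hsplit := Finset.add_sum_erase Finset.univ (fun j => (n j).natAbs) (Finset.mem_univ i)
  rw [← l1Norm, h] at hsplit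
  have h0 : ∑ j ∈ Finset.univ.erase i, (n j).natAbs = 0 := by
    have := Int.natAbs_ne_zero.2 hi
    omega
  have h1 : (n i).natAbs = 1 := by
    omega
  have hne : ∀ j, j ≠ i → n j = 0 := fun j hj =>
    Int.natAbs_eq_zero.1 (Finset.sum_eq_zero_iff.1 h0 j (by simp [hj]))
  have hmem : (Pi.single i 1 : Fin m → ℤ) ∈ columnSubgroup M := by
    rcases Int.natAbs_eq_iff.1 h1 with h1 | h1
    · convert hn using 1
      funext j
      by_cases hj : j = i
      · subst hj; simp [h1]
      · simp [hj, hne j hj]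
    · convert neg_mem hn using 1
      funext j
      by_cases hj : j = i
      · subst hj; simp [h1]
      · simp [hj, hne j hj]
  refine ⟨0, QuotientAddGroup.mk (Pi.single i 1), ⟨i, Or.inl rfl⟩, ?_⟩
  rw [(QuotientAddGroup.eq_zero_iff _).2 hmem, add_zero]

end Coloring

theorem mainTheorem2 (M : Matrix (Fin 5) (Fin 2) ℤ)
    (hrow : ∀ i : Fin 5, M.row i ≠ 0)
    (hbip : ¬ (SACG M).IsBipartite)
    (hloop : ¬ (SACG M).HasLoops) :
    (SACG M).chromaticNumber = 3 := by
  refine LoopGraph.chromaticNumber_eq_three (SACG_colorable_three M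
    (admitsPhases_of_odd (fun i => ?_) (fun p q h => ?_) ?_)) hbip
  · by_contra! h
    refine hrow i (funext fun j => ?_)
    fin_cases j
    · exact h.1
    · exact h.2
  · refine hloop (SACG_hasLoops_of_l1Norm_eq_one M ?_ h)
    have hcol : ∀ j, M.col j ∈ columnSubgroup M := fun j =>
      AddSubgroup.subset_closure ⟨j, rfl⟩
    convert add_mem (zsmul_mem (hcol 0) p) (zsmul_mem (hcol 1) q) using 1
    funext i
    simp
  · by_contra! h
    refine hbip (SACG_isBipartite_of_even M fun j => ?_)
    fin_cases j
    · exact Int.not_odd_iff_even.1 h.1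
    · exact Int.not_odd_iff_even.1 h.2
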